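/- Let $\mathcal M_S$ be the set of all probability distributions $P=(p_1,\dots,p_S)$ on $S$ symbols, and let $$R(S,n)=\inf_{\hat P}\ \sup_{P\in\mathcal M_S}\ \mathbb E_P\|\hat P-P\|_1$$ be the minimax $\ell_1$ risk from $n$ independent samples of $P$, where the infimum is over all estimators, that is, all functions $\hat P$ of the $n$ samples with values in $\mathbb R^S$ (the estimates need not be probability vectors), and $\|q-p\|_1=\sum_{i=1}^S|q_i-p_i|$. Let $P_n$ be the empirical distribution of the $n$ samples (the maximum likelihood estimator). (1) If $S=n/c$, rounded to an integer in any way (more precisely, for any integers $S=S(c,n)\ge 0$ with $S(c,n)/n\to 1/c$ as $n\to\infty$ for every $c>0$), then $$\liminf_{c\to\infty}\ \sqrt c\cdot\liminf_{n\to\infty} R(S,n)\ \ge\ \frac{\sqrt e}{8}\ >\ 0 .$$ (2) Hence a number of samples of order $S$ is necessary: for every $C>0$ there is $\varepsilon>0$ such that $R(S,n)\ge\varepsilon$ for all integers $S\ge 2$ and $n\ge 0$ with $n\le CS$. In particular, no estimator is consistent when $n=o(S)$. (3) The maximum likelihood estimator attains the optimal rate $\Theta(c^{-1/2})$: there are constants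 $a,A,c_0>0$ such that for every $c\ge c_0$ and all integers $S=S(n)\ge 0$ with $S(n)/n\to 1/c$ as $n\to\infty$, $$\frac{a}{\sqrt c}\ \le\ \liminf_{n\to\infty}R(S,n)\ \le\ \limsup_{n\to\infty}\ \sup_{P\in\mathcal M_S}\mathbb E_P\|P_n-P\|_1\ \le\ \frac{A}{\sqrt c}.$$ -/

import Mathlib

open Filter Topology MeasureTheory
open scoped ENNReal

noncomputable section

/-- An estimator of a distribution on the alphabet `Fin S` from `n` samples: an arbitrary function
of the sample with values in real vectors (the estimate need not be a probability vector). -/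
abbrev Estimator (S n : ℕ) : Type := (Fin n → Fin S) → Fin S → ℝ

/-- The `ℓ¹` distance between the estimate `q` and the distribution `P`. -/
def l1Loss {S : ℕ} (q : Fin S → ℝ) (P : PMF (Fin S)) : ℝ :=
  ∑ i, |q i - (P i).toReal|

/-- The law of `n` independent samples from `P`. -/
def sampleLaw {S : ℕ} (n : ℕ) (P : PMF (Fin S)) : Measure (Fin n → Fin S) :=
  Measure.pi fun _ => P.toMeasure

/-- The expected `ℓ¹` loss of an estimator when the `n` samples are drawn from `P`. -/
def risk {S n : ℕ} (est : Estimator S n) (P : PMF (Fin S)) : ℝ≥0∞ :=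
  ∫⁻ x, ENNReal.ofReal (l1Loss (est x) P) ∂(sampleLaw n P)

/-- The maximum risk of an estimator over all distributions on `S` symbols. -/
def maxRisk {S n : ℕ} (est : Estimator S n) : ℝ≥0∞ :=
  ⨆ P : PMF (Fin S), risk est P

/-- The minimax `ℓ¹` risk over all distributions on `S` symbols, from `n` samples. -/
def minimaxRisk (S n : ℕ) : ℝ≥0∞ :=
  ⨅ est : Estimator S n, maxRisk est

/-- The empirical distribution (the maximum likelihood estimator). -/
def empirical (S n : ℕ) : Estimator S n :=
  fun x i => ((Finset.univ.filter fun k => x k = i).card : ℝ) / n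

end

/-!
The lower bound is Assouad's argument on an exact sub-family of the simplex. On `m + 1` symbols,
give symbol `i + 1` the mass `b (1 ± δ)` with independent choices of sign, `b = (1 - 2 δ) / m`, and
let symbol `0` absorb the rest (`cubeWeight`). Its mass is always at least `δ`, so reversing one
sign costs squared Hellinger distance at most `δ² / m + δ / m²`
(`hellinger_cubeWeight_flipAt_le`). The overlap of the two sample laws is then at least
`1 - √(n (δ² / m + δ / m²))` (`one_sub_sqrt_hellinger_le_sum_min_prod`), and averaging over all
signs gives the bound valid for every sample size (`le_minimaxRisk_succ`)

  `R(m + 1, n) ≥ δ (1 - 2 δ) (1 - √(n (δ² / m + δ / m²)))`.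

When `S / n → 1 / c` the right side tends to `δ (1 - 2 δ) (1 - √c δ)`; with `δ = 1 / (2 √c)` this
is `(1 - 1 / √c) / (4 √c)`, which exceeds `√e / (8 √c)` for large `c`, because `√e < 2`. When
`n ≤ C S`, a small fixed `δ` keeps the overlap at least `1 / 2`, hence a uniform positive bound.
The empirical distribution has maximum risk at most `√(S / n)` by a variance bound
(`maxRisk_empirical_le`), which is the matching rate.
-/

lemma risk_eq_ofReal_sum {S n : ℕ} (est : Estimator S n) (P : PMF (Fin S)) :
    risk est P =
      ENNReal.ofReal (∑ x : Fin n → Fin S, (∏ k, (P (x k)).toReal) * l1Loss (est x) P) := by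
  have hl : ∀ x, 0 ≤ l1Loss (est x) P := fun x => Finset.sum_nonneg fun i _ => abs_nonneg _
  have hp : ∀ x : Fin n → Fin S, 0 ≤ ∏ k, (P (x k)).toReal := fun x =>
    Finset.prod_nonneg fun k _ => ENNReal.toReal_nonneg
  rw [risk, lintegral_fintype, ENNReal.ofReal_sum_of_nonneg fun x _ => mul_nonneg (hp x) (hl x)]
  refine Finset.sum_congr rfl fun x _ => ?_
  rw [ENNReal.ofReal_mul (hp x), mul_comm,
    ENNReal.ofReal_prod_of_nonneg fun k _ => ENNReal.toReal_nonneg, sampleLaw,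
    Measure.pi_singleton]
  congr 1
  refine Finset.prod_congr rfl fun k _ => ?_
  rw [PMF.toMeasure_apply_singleton _ _ (measurableSet_singleton _),
    ENNReal.ofReal_toReal (P.apply_ne_top _)]

lemma exists_pmf_toReal_eq {α : Type*} [Fintype α] (p : α → ℝ) (h0 : ∀ a, 0 ≤ p a)
    (h1 : ∑ a, p a = 1) : ∃ P : PMF α, ∀ a, (P a).toReal = p a := by
  refine ⟨PMF.ofFintype (fun a => ENNReal.ofReal (p a)) ?_, fun a => ?_⟩
  · rw [← ENNReal.ofReal_sum_of_nonneg fun a _ => h0 a, h1, ENNReal.ofReal_one]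
  · simp [PMF.ofFintype_apply, ENNReal.toReal_ofReal (h0 a)]

/-! ### Hellinger bound for product laws -/

/-- Le Cam's inequality: the overlap `M` of two `n`-fold product laws is at least `1 - √(n * h)`,
where `h` is the squared Hellinger distance of the factors. The affinity `ρ` of the factors
tensorizes to `ρ ^ n`, Cauchy-Schwarz for `√L √L' = √(min L L') √(max L L')` gives
`ρ ^ (2 * n) ≤ M * (2 - M) = 1 - (1 - M) ^ 2`, and `h = 2 * (1 - ρ)`. -/
lemma one_sub_sqrt_hellinger_le_sum_min_prod {α : Type*} [Fintype α] (n : ℕ) (p q : α → ℝ)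
    (hp0 : ∀ a, 0 ≤ p a) (hq0 : ∀ a, 0 ≤ q a) (hp : ∑ a, p a = 1) (hq : ∑ a, q a = 1) :
    1 - √(n * ∑ a, (√(p a) - √(q a)) ^ 2) ≤
      ∑ x : Fin n → α, min (∏ k, p (x k)) (∏ k, q (x k)) := by
  set L : (Fin n → α) → ℝ := fun x => ∏ k, p (x k)
  set L' : (Fin n → α) → ℝ := fun x => ∏ k, q (x k)
  set M := ∑ x, min (L x) (L' x) with hM
  set ρ := ∑ a, √(p a) * √(q a) with hρ
  have hL0 : ∀ x, 0 ≤ L x := fun x => Finset.prod_nonneg fun k _ => hp0 _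
  have hL0' : ∀ x, 0 ≤ L' x := fun x => Finset.prod_nonneg fun k _ => hq0 _
  have hL1 : ∑ x, L x = 1 := by rw [← Fintype.sum_pow, hp, one_pow]
  have hL1' : ∑ x, L' x = 1 := by rw [← Fintype.sum_pow, hq, one_pow]
  have hmax : ∑ x, max (L x) (L' x) = 2 - M := by
    rw [eq_sub_iff_add_eq, hM, ← Finset.sum_add_distrib]
    simp only [max_add_min, Finset.sum_add_distrib, hL1, hL1']
    norm_num
  have hρn : ∑ x, √(min (L x) (L' x)) * √(max (L x) (L' x)) = ρ ^ n := by
    rw [hρ, Fintype.sum_pow]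
    refine Finset.sum_congr rfl fun x _ => ?_
    rw [← Real.sqrt_mul (le_min (hL0 x) (hL0' x)), min_mul_max, Finset.prod_mul_distrib,
      Real.sqrt_mul (hL0 x), Real.sqrt_prod _ fun k _ => hp0 _, Real.sqrt_prod _ fun k _ => hq0 _]
  have hCS : (ρ ^ n) ^ 2 ≤ M * (2 - M) := by
    rw [← hρn, ← hmax, hM]
    refine (Finset.sum_mul_sq_le_sq_mul_sq _ _ _).trans_eq ?_
    congr 1 <;> refine Finset.sum_congr rfl fun x _ => Real.sq_sqrt ?_
    · exact le_min (hL0 x) (hL0' x)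
    · exact le_max_of_le_left (hL0 x)
  have hH : ∑ a, (√(p a) - √(q a)) ^ 2 = 2 * (1 - ρ) := by
    have : ∀ a, (√(p a) - √(q a)) ^ 2 = p a + q a - 2 * (√(p a) * √(q a)) := fun a => by
      rw [sub_sq, Real.sq_sqrt (hp0 a), Real.sq_sqrt (hq0 a)]; ring
    simp only [this, Finset.sum_sub_distrib, Finset.sum_add_distrib, hp, hq, ← Finset.mul_sum,
      ← hρ]
    ring
  have hρ0 : 0 ≤ ρ := Finset.sum_nonneg fun a _ => by positivity
  -- Bernoulli's inequality with exponent `2 * n`.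
  have hB : 1 - 2 * n * (1 - ρ) ≤ (ρ ^ n) ^ 2 := by
    have := one_add_mul_le_pow (a := ρ - 1) (by linarith) (n * 2)
    rw [← pow_mul]
    push_cast at this
    rw [add_sub_cancel] at this
    linarith
  have : 1 - M ≤ √(n * ∑ a, (√(p a) - √(q a)) ^ 2) := by
    refine Real.le_sqrt_of_sq_le ?_
    rw [hH]
    nlinarith
  linarith

lemma sq_sqrt_sub_sqrt_le {l p q : ℝ} (hl : 0 < l) (hp : l ≤ p) (hq : l ≤ q) :
    (√p - √q) ^ 2 ≤ (p - q) ^ 2 / (4 * l) := by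
  have h1 := Real.sqrt_le_sqrt hp
  have h2 := Real.sqrt_le_sqrt hq
  have h3 : 4 * l ≤ (√p + √q) ^ 2 := by
    nlinarith [Real.sq_sqrt hl.le, Real.sqrt_nonneg l]
  rw [le_div_iff₀ (by positivity)]
  calc (√p - √q) ^ 2 * (4 * l) ≤ (√p - √q) ^ 2 * (√p + √q) ^ 2 := by gcongr
    _ = (√p ^ 2 - √q ^ 2) ^ 2 := by ring
    _ = (p - q) ^ 2 := by rw [Real.sq_sqrt (hl.le.trans hp), Real.sq_sqrt (hl.le.trans hq)]

/-! ### The perturbation cube -/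

/-- The sign of a coordinate of a vertex of the cube `Fin m → Bool`: `1` for `true`, `-1` for
`false`. -/
noncomputable def boolSign (t : Bool) : ℝ := if t then 1 else -1

lemma abs_boolSign_le (t : Bool) : |boolSign t| ≤ 1 := by cases t <;> simp [boolSign]

lemma abs_boolSign_sub_not (t : Bool) : |boolSign t - boolSign !t| = 2 := by
  cases t <;> norm_num [boolSign]

/-- The neighbour of the vertex `v` across coordinate `i`. -/
def flipAt {m : ℕ} (i : Fin m) (v : Fin m → Bool) : Fin m → Bool := Function.update v i !(v i)

lemma flipAt_involutive {m : ℕ} (i : Fin m) : Function.Involutive (flipAt i) := fun v => by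
  simp [flipAt]

/-- The distribution on `m + 1` symbols attached to a vertex `v` of the cube: symbol `i.succ` has
mass `b * (1 ± δ)` with `b = (1 - 2 * δ) / m`, the sign being that of `v i`, and symbol `0` carries
what is missing to total mass `1`. The factor `1 - 2 * δ` keeps the mass of symbol `0` at least
`δ` at every vertex, see `le_cubeWeight_zero`. -/
noncomputable def cubeWeight {m : ℕ} (δ : ℝ) (v : Fin m → Bool) : Fin (m + 1) → ℝ :=
  Fin.cons (1 - ∑ i, (1 - 2 * δ) / m * (1 + boolSign (v i) * δ))
    fun i => (1 - 2 * δ) / m * (1 + boolSign (v i) * δ)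

section
variable {m : ℕ} {δ : ℝ}

lemma cubeWeight_zero (v : Fin m → Bool) :
    cubeWeight δ v 0 = 1 - ∑ i, (1 - 2 * δ) / m * (1 + boolSign (v i) * δ) := rfl

lemma cubeWeight_succ (v : Fin m → Bool) (i : Fin m) :
    cubeWeight δ v i.succ = (1 - 2 * δ) / m * (1 + boolSign (v i) * δ) := rfl

lemma sum_cubeWeight (v : Fin m → Bool) : ∑ a, cubeWeight δ v a = 1 := by
  rw [Fin.sum_univ_succ, cubeWeight_zero]
  simp only [cubeWeight_succ, sub_add_cancel]

lemma le_cubeWeight_succ (h0 : 0 < δ) (h1 : δ < 1 / 2) (v : Fin m → Bool) (i : Fin m) :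
    (1 - 2 * δ) / m * (1 - δ) ≤ cubeWeight δ v i.succ := by
  have := (abs_le.1 (abs_boolSign_le (v i))).1
  have hb : 0 ≤ (1 - 2 * δ) / m := div_nonneg (by linarith) (by positivity)
  rw [cubeWeight_succ]
  exact mul_le_mul_of_nonneg_left (by nlinarith) hb

lemma le_cubeWeight_zero (hm : 0 < m) (h0 : 0 < δ) (h1 : δ < 1 / 2) (v : Fin m → Bool) :
    δ ≤ cubeWeight δ v 0 := by
  have hm' : (0 : ℝ) < m := by exact_mod_cast hm
  have hb : 0 ≤ (1 - 2 * δ) / m := div_nonneg (by linarith) (by positivity)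
  have : ∑ i, (1 - 2 * δ) / m * (1 + boolSign (v i) * δ) ≤
      ∑ _i : Fin m, (1 - 2 * δ) / m * (1 + δ) := by
    refine Finset.sum_le_sum fun i _ => mul_le_mul_of_nonneg_left ?_ hb
    have := (abs_le.1 (abs_boolSign_le (v i))).2
    nlinarith
  rw [Finset.sum_const, Finset.card_univ, Fintype.card_fin, nsmul_eq_mul, ← mul_assoc,
    mul_div_cancel₀ _ hm'.ne'] at this
  rw [cubeWeight_zero]
  nlinarith

lemma cubeWeight_nonneg (hm : 0 < m) (h0 : 0 < δ) (h1 : δ < 1 / 2) (v : Fin m → Bool)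
    (a : Fin (m + 1)) : 0 ≤ cubeWeight δ v a := by
  refine Fin.cases (h0.le.trans (le_cubeWeight_zero hm h0 h1 v)) (fun i => ?_) a
  exact (mul_nonneg (div_nonneg (by linarith) (by positivity)) (by linarith)).trans
    (le_cubeWeight_succ h0 h1 v i)

lemma abs_cubeWeight_succ_sub_flipAt (h0 : 0 < δ) (h1 : δ < 1 / 2) (v : Fin m → Bool)
    (i : Fin m) :
    |cubeWeight δ v i.succ - cubeWeight δ (flipAt i v) i.succ| = 2 * ((1 - 2 * δ) / m * δ) := by
  have hb : 0 ≤ (1 - 2 * δ) / m := div_nonneg (by linarith) (by positivity)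
  rw [cubeWeight_succ, cubeWeight_succ, flipAt, Function.update_self]
  rw [show ∀ b s t : ℝ, b * (1 + s * δ) - b * (1 + t * δ) = (s - t) * (b * δ) by intros; ring,
    abs_mul, abs_boolSign_sub_not, abs_of_nonneg (by positivity)]

lemma cubeWeight_succ_flipAt_of_ne (v : Fin m → Bool) {i j : Fin m} (h : j ≠ i) :
    cubeWeight δ (flipAt i v) j.succ = cubeWeight δ v j.succ := by
  rw [cubeWeight_succ, cubeWeight_succ, flipAt, Function.update_of_ne h]

/-- Symbol `0` compensates exactly the mass that symbol `i.succ` gains or loses. -/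
lemma cubeWeight_zero_sub_flipAt (v : Fin m → Bool) (i : Fin m) :
    cubeWeight δ v 0 - cubeWeight δ (flipAt i v) 0 =
      -(cubeWeight δ v i.succ - cubeWeight δ (flipAt i v) i.succ) := by
  have h1 := sum_cubeWeight (δ := δ) v
  have h2 := sum_cubeWeight (δ := δ) (flipAt i v)
  rw [Fin.sum_univ_succ, ← Finset.add_sum_erase _ _ (Finset.mem_univ i)] at h1 h2
  rw [Finset.sum_congr rfl fun j hj => cubeWeight_succ_flipAt_of_ne v (Finset.ne_of_mem_erase hj)]
    at h2
  linarith

/-- Adjacent vertices differ at two symbols. Symbol `i.succ` contributes the main term `δ ^ 2 / m`;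
the absorbing symbol contributes `δ / m ^ 2`, which is of lower order in `m`. -/
lemma hellinger_cubeWeight_flipAt_le (hm : 0 < m) (h0 : 0 < δ) (h1 : δ < 1 / 2)
    (v : Fin m → Bool) (i : Fin m) :
    ∑ a, (√(cubeWeight δ v a) - √(cubeWeight δ (flipAt i v) a)) ^ 2 ≤
      δ ^ 2 / m + δ / (m : ℝ) ^ 2 := by
  have hm' : (0 : ℝ) < m := by exact_mod_cast hm
  have h2 : 0 < 1 - 2 * δ := by linarith
  have h3 : 0 < 1 - δ := by linarith
  have hd : (cubeWeight δ v i.succ - cubeWeight δ (flipAt i v) i.succ) ^ 2 =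
      (2 * ((1 - 2 * δ) / m * δ)) ^ 2 := by
    rw [← abs_cubeWeight_succ_sub_flipAt h0 h1 v i, sq_abs]
  rw [Fin.sum_univ_succ, Finset.sum_eq_single i]
  · rw [add_comm]
    refine add_le_add ?_ ?_
    · refine (sq_sqrt_sub_sqrt_le (by positivity) (le_cubeWeight_succ h0 h1 v i)
        (le_cubeWeight_succ h0 h1 (flipAt i v) i)).trans ?_
      rw [hd]
      calc _ = (1 - 2 * δ) / (1 - δ) * (δ ^ 2 / m) := by field_simp; norm_num
        _ ≤ 1 * (δ ^ 2 / m) := by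
          gcongr
          rw [div_le_one h3]; linarith
        _ = _ := one_mul _
    · refine (sq_sqrt_sub_sqrt_le h0 (le_cubeWeight_zero hm h0 h1 v)
        (le_cubeWeight_zero hm h0 h1 (flipAt i v))).trans ?_
      rw [cubeWeight_zero_sub_flipAt, neg_sq, hd]
      calc _ = (1 - 2 * δ) ^ 2 * (δ / (m : ℝ) ^ 2) := by field_simp; norm_num
        _ ≤ 1 * (δ / (m : ℝ) ^ 2) := by
          gcongr
          nlinarith
        _ = _ := one_mul _
  · intro j _ hj
    rw [cubeWeight_succ_flipAt_of_ne v hj]; simp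
  · simp

/-! ### The minimax lower bound -/

/-- The two-point bound: no value `q` is close to both `s` and `t`. -/
lemma min_mul_abs_sub_le {L L' : ℝ} (hL : 0 ≤ L) (hL' : 0 ≤ L') (q s t : ℝ) :
    min L L' * |s - t| ≤ L * |q - s| + L' * |q - t| := by
  have h : |s - t| ≤ |q - s| + |q - t| := by
    rw [abs_sub_comm q s]; exact abs_sub_le s q t
  calc min L L' * |s - t| ≤ min L L' * (|q - s| + |q - t|) :=
        mul_le_mul_of_nonneg_left h (le_min hL hL')
    _ ≤ L * |q - s| + L' * |q - t| := by
        rw [mul_add]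
        gcongr
        exacts [min_le_left _ _, min_le_right _ _]

/-- Assouad's argument on the cube: for each coordinate `i`, pairing every vertex with its neighbour
across `i` bounds the loss at symbol `i.succ`, averaged over the cube, from below by `b * δ` times
the overlap of the two sample laws; the `m` coordinates together give `m * b * δ = δ * (1 - 2 * δ)`,
and some vertex is at least as bad as the average. -/
lemma le_minimaxRisk_succ (n : ℕ) (hm : 0 < m) (h0 : 0 < δ) (h1 : δ < 1 / 2) :
    ENNReal.ofReal (δ * (1 - 2 * δ) * (1 - √(n * (δ ^ 2 / m + δ / (m : ℝ) ^ 2)))) ≤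
      minimaxRisk (m + 1) n := by
  refine le_iInf fun est => ?_
  have hm' : (0 : ℝ) < m := by exact_mod_cast hm
  set M := 1 - √(n * (δ ^ 2 / m + δ / (m : ℝ) ^ 2)) with hM
  set b := (1 - 2 * δ) / m with hb
  have hb0 : 0 ≤ b := div_nonneg (by linarith) hm'.le
  let L (v : Fin m → Bool) (x : Fin n → Fin (m + 1)) : ℝ := ∏ k, cubeWeight δ v (x k)
  have hL0 : ∀ v x, 0 ≤ L v x := fun v x =>
    Finset.prod_nonneg fun k _ => cubeWeight_nonneg hm h0 h1 v _
  let g (i : Fin m) (v : Fin m → Bool) : ℝ :=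
    ∑ x, L v x * |est x i.succ - cubeWeight δ v i.succ|
  have hpair : ∀ i v, 2 * (b * δ * M) ≤ g i v + g i (flipAt i v) := by
    intro i v
    have hmin : M ≤ ∑ x, min (L v x) (L (flipAt i v) x) := by
      refine le_trans ?_ (one_sub_sqrt_hellinger_le_sum_min_prod n _ _
        (cubeWeight_nonneg hm h0 h1 v) (cubeWeight_nonneg hm h0 h1 (flipAt i v))
        (sum_cubeWeight v) (sum_cubeWeight _))
      have := hellinger_cubeWeight_flipAt_le hm h0 h1 v i
      rw [hM]
      gcongr
    calc 2 * (b * δ * M) ≤ (∑ x, min (L v x) (L (flipAt i v) x)) * (2 * (b * δ)) := by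
          rw [← mul_assoc, mul_comm]; gcongr
      _ = ∑ x, min (L v x) (L (flipAt i v) x) *
            |cubeWeight δ v i.succ - cubeWeight δ (flipAt i v) i.succ| := by
          rw [abs_cubeWeight_succ_sub_flipAt h0 h1, Finset.sum_mul]
      _ ≤ ∑ x, (L v x * |est x i.succ - cubeWeight δ v i.succ| +
            L (flipAt i v) x * |est x i.succ - cubeWeight δ (flipAt i v) i.succ|) :=
          Finset.sum_le_sum fun x _ => min_mul_abs_sub_le (hL0 _ x) (hL0 _ x) _ _ _
      _ = _ := Finset.sum_add_distrib
  have hcoord : ∀ i, ∑ _v : Fin m → Bool, b * δ * M ≤ ∑ v, g i v := by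
    intro i
    have hflip : ∑ v, g i (flipAt i v) = ∑ v, g i v :=
      Equiv.sum_comp (flipAt_involutive i).toPerm (g i)
    have := Finset.sum_le_sum fun v (_ : v ∈ Finset.univ) => hpair i v
    rw [Finset.sum_add_distrib, hflip, ← Finset.mul_sum] at this
    linarith
  have hsum : ∑ _v : Fin m → Bool, δ * (1 - 2 * δ) * M ≤ ∑ v, ∑ i, g i v := by
    rw [Finset.sum_comm]
    calc _ = ∑ _i : Fin m, ∑ _v : Fin m → Bool, b * δ * M := by
          rw [Finset.sum_comm]
          refine Finset.sum_congr rfl fun v _ => ?_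
          rw [Finset.sum_const, Finset.card_univ, Fintype.card_fin, nsmul_eq_mul, hb]
          field_simp
      _ ≤ _ := Finset.sum_le_sum fun i _ => hcoord i
  obtain ⟨v, -, hv⟩ := Finset.exists_le_of_sum_le Finset.univ_nonempty hsum
  obtain ⟨P, hP⟩ := exists_pmf_toReal_eq (cubeWeight δ v) (cubeWeight_nonneg hm h0 h1 v)
    (sum_cubeWeight v)
  refine le_trans ?_ (le_iSup (risk est) P)
  rw [risk_eq_ofReal_sum]
  refine ENNReal.ofReal_le_ofReal (hv.trans ?_)
  rw [Finset.sum_comm]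
  refine Finset.sum_le_sum fun x _ => ?_
  simp only [hP, l1Loss]
  -- The loss at the absorbing symbol is discarded.
  rw [← Finset.mul_sum, Fin.sum_univ_succ]
  exact mul_le_mul_of_nonneg_left (le_add_of_nonneg_left (abs_nonneg _)) (hL0 v x)

end

/-! ### Risk of the empirical distribution -/

open ProbabilityTheory in
lemma integral_abs_sub_integral_le_sqrt_variance {Ω : Type*} [Finite Ω] [MeasurableSpace Ω]
    [MeasurableSingletonClass Ω] (μ : Measure Ω) [IsProbabilityMeasure μ] (X : Ω → ℝ) :
    ∫ ω, |X ω - ∫ ω', X ω' ∂μ| ∂μ ≤ √(Var[X; μ]) := by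
  refine Real.le_sqrt_of_sq_le ?_
  have h := variance_nonneg (fun ω => |X ω - ∫ ω', X ω' ∂μ|) μ
  rw [variance_eq_sub .of_discrete] at h
  rw [variance_eq_integral (Measurable.of_discrete).aemeasurable]
  simpa [sq_abs] using h

lemma sum_toReal_pmf {S : ℕ} (P : PMF (Fin S)) : ∑ i, (P i).toReal = 1 := by
  rw [← ENNReal.toReal_sum fun i _ => P.apply_ne_top i, ← tsum_fintype (L := .unconditional _), P.tsum_coe,
    ENNReal.toReal_one]

open ProbabilityTheory in
lemma integral_abs_empirical_sub_le {S n : ℕ} (hn : 0 < n) (P : PMF (Fin S)) (i : Fin S) :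
    ∫ x, |empirical S n x i - (P i).toReal| ∂(sampleLaw n P) ≤ √((P i).toReal / n) := by
  have hn' : (0 : ℝ) < n := by exact_mod_cast hn
  have : IsProbabilityMeasure (sampleLaw n P) := by unfold sampleLaw; infer_instance
  let f : Fin S → ℝ := fun a => if a = i then 1 else 0
  have hf : ∫ a, f a ∂P.toMeasure = (P i).toReal := by
    rw [PMF.integral_eq_sum]; simp [f]
  have hvar : Var[f; P.toMeasure] ≤ (P i).toReal := by
    refine (variance_le_expectation_sq (Measurable.of_discrete).aestronglyMeasurable).trans_eq ?_
    rw [← hf]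
    congr 1; ext a; simp [f]
  have hemp : (fun x => empirical S n x i) =
      fun x => (n : ℝ)⁻¹ * (∑ k : Fin n, fun x : Fin n → Fin S => f (x k)) x := by
    ext x
    simp only [empirical, f, Finset.sum_apply, Finset.sum_boole, div_eq_inv_mul]
  have hmean : ∫ x, empirical S n x i ∂(sampleLaw n P) = (P i).toReal := by
    have hk : ∀ k : Fin n, ∫ x, f (x k) ∂(sampleLaw n P) = (P i).toReal := fun k => by
      rw [← hf]
      exact integral_comp_eval (μ := fun _ : Fin n => P.toMeasure)
        (Measurable.of_discrete).aestronglyMeasurable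
    rw [hemp, integral_const_mul]
    simp only [Finset.sum_apply]
    rw [integral_finsetSum _ fun k _ => .of_finite]
    simp only [hk, Finset.sum_const, Finset.card_univ, Fintype.card_fin, nsmul_eq_mul]
    field_simp
  have hV : Var[fun x => empirical S n x i; sampleLaw n P] ≤ (P i).toReal / n := by
    rw [hemp, variance_const_mul, sampleLaw, variance_sum_pi fun _ => .of_discrete, Finset.sum_const,
      Finset.card_univ, Fintype.card_fin, nsmul_eq_mul]
    calc _ = Var[f; P.toMeasure] / n := by field_simp
      _ ≤ _ := by gcongr
  have := integral_abs_sub_integral_le_sqrt_variance (sampleLaw n P) fun x => empirical S n x i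
  rw [hmean] at this
  exact this.trans (Real.sqrt_le_sqrt hV)

/-- The standard deviation of the `i`-th frequency is at most `√(p i / n)`, and by Cauchy-Schwarz
these add up to at most `√(S / n)`. -/
lemma maxRisk_empirical_le {S n : ℕ} (hn : 0 < n) :
    maxRisk (empirical S n) ≤ ENNReal.ofReal √((S : ℝ) / n) := by
  refine iSup_le fun P => ?_
  have : IsProbabilityMeasure (sampleLaw n P) := by unfold sampleLaw; infer_instance
  simp only [risk, l1Loss]
  rw [← ofReal_integral_eq_lintegral_ofReal .of_finite
    (.of_forall fun x => Finset.sum_nonneg fun i _ => abs_nonneg _)]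
  refine ENNReal.ofReal_le_ofReal ?_
  rw [integral_finsetSum _ fun i _ => .of_finite]
  refine (Finset.sum_le_sum fun i _ => integral_abs_empirical_sub_le hn P i).trans ?_
  have := Real.sum_sqrt_mul_sqrt_le Finset.univ (f := fun i => (P i).toReal / n)
    (g := fun _ : Fin S => (1 : ℝ)) (fun i => by positivity) fun i => zero_le_one
  simp only [Real.sqrt_one, mul_one] at this
  refine this.trans_eq ?_
  rw [← Finset.sum_div, sum_toReal_pmf, Finset.sum_const, Finset.card_univ, Fintype.card_fin,
    nsmul_eq_mul, mul_one, ← Real.sqrt_mul (by positivity), one_div_mul_eq_div]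

/-! ### Asymptotics -/

lemma le_liminf_minimaxRisk {c δ : ℝ} (hc : 0 < c) (h0 : 0 < δ) (h1 : δ < 1 / 2) {S : ℕ → ℕ}
    (hS : Tendsto (fun n : ℕ => (S n : ℝ) / n) atTop (𝓝 (1 / c))) :
    ENNReal.ofReal (δ * (1 - 2 * δ) * (1 - √(c * δ ^ 2))) ≤
      liminf (fun n : ℕ => minimaxRisk (S n) n) atTop := by
  have hinv : Tendsto (fun n : ℕ => (n : ℝ)⁻¹) atTop (𝓝 0) :=
    tendsto_inv_atTop_zero.comp tendsto_natCast_atTop_atTop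
  have hS1 : ∀ᶠ n in atTop, 2 ≤ S n := by
    have hpos : ∀ᶠ n : ℕ in atTop, (n : ℝ)⁻¹ < (S n : ℝ) / n :=
      hinv.eventually_lt hS (by positivity)
    filter_upwards [hpos, eventually_gt_atTop 0] with n h hn
    have hn' : (0 : ℝ) < n := by exact_mod_cast hn
    rw [inv_eq_one_div, div_lt_div_iff_of_pos_right hn'] at h
    exact_mod_cast h
  have hm : Tendsto (fun n : ℕ => ((S n - 1 : ℕ) : ℝ) / n) atTop (𝓝 (1 / c)) := by
    have := hS.sub hinv
    rw [sub_zero] at this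
    refine this.congr' ?_
    filter_upwards [hS1] with n hn
    rw [Nat.cast_sub (by omega), Nat.cast_one, sub_div, one_div]
  have hr : Tendsto (fun n : ℕ => (n : ℝ) / (S n - 1 : ℕ)) atTop (𝓝 c) := by
    simpa using hm.inv₀ (by positivity)
  have hlim : Tendsto (fun n : ℕ => ENNReal.ofReal (δ * (1 - 2 * δ) *
      (1 - √(n * (δ ^ 2 / (S n - 1 : ℕ) + δ / ((S n - 1 : ℕ) : ℝ) ^ 2))))) atTop
      (𝓝 (ENNReal.ofReal (δ * (1 - 2 * δ) * (1 - √(c * δ ^ 2))))) := by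
    have hin : Tendsto (fun n : ℕ => (n : ℝ) * (δ ^ 2 / (S n - 1 : ℕ) +
        δ / ((S n - 1 : ℕ) : ℝ) ^ 2)) atTop (𝓝 (c * δ ^ 2)) := by
      have := (hr.mul_const (δ ^ 2)).add (((hr.mul hr).mul hinv).mul_const δ)
      rw [mul_zero, zero_mul, add_zero] at this
      refine this.congr' ?_
      filter_upwards [eventually_gt_atTop 0] with n hn
      have hn' : (n : ℝ) ≠ 0 := by exact_mod_cast hn.ne'
      field_simp
    exact ENNReal.tendsto_ofReal
      (((Real.continuous_sqrt.tendsto _).comp hin).const_sub 1 |>.const_mul _)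
  rw [← hlim.liminf_eq]
  refine liminf_le_liminf ?_
  filter_upwards [hS1] with n hn
  have := le_minimaxRisk_succ (m := S n - 1) n (by omega) h0 h1
  rwa [Nat.sub_add_cancel (by omega)] at this

/-- The choice `δ = 1 / (2 * √c)` maximizes `δ * (1 - √c * δ)`, the main part of the bound, with
maximum `1 / (4 * √c)`; since `√e / 2 < 9 / 10`, the remaining factor `1 - 1 / √c` is affordable
from `c = 100` on. -/
lemma sqrt_exp_one_div_le_liminf_minimaxRisk {c : ℝ} (hc : 100 ≤ c) {S : ℕ → ℕ}
    (hS : Tendsto (fun n : ℕ => (S n : ℝ) / n) atTop (𝓝 (1 / c))) :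
    ENNReal.ofReal (√(Real.exp 1) / 8 / √c) ≤
      liminf (fun n : ℕ => minimaxRisk (S n) n) atTop := by
  have hc0 : 0 < c := by linarith
  have hs : (10 : ℝ) ≤ √c := Real.le_sqrt_of_sq_le (by linarith)
  have hs0 : 0 < √c := by linarith
  have he : √(Real.exp 1) ≤ 9 / 5 := by
    rw [Real.sqrt_le_left (by norm_num)]
    linarith [Real.exp_one_lt_d9]
  have hδ : 1 / (2 * √c) < 1 / 2 := by
    rw [div_lt_div_iff₀ (by positivity) (by norm_num)]; linarith
  refine le_trans (ENNReal.ofReal_le_ofReal ?_)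
    (le_liminf_minimaxRisk hc0 (δ := 1 / (2 * √c)) (by positivity) hδ hS)
  have h4 : √(c * (1 / (2 * √c)) ^ 2) = 1 / 2 := by
    rw [div_pow, mul_pow, Real.sq_sqrt hc0.le, Real.sqrt_eq_iff_eq_sq (by positivity) (by norm_num)]
    field_simp
  have h5 : 1 / √c ≤ 1 / 10 := by gcongr
  rw [h4]
  calc √(Real.exp 1) / 8 / √c ≤ (9 / 10) / 4 / √c := by gcongr ?_ / _; linarith
    _ ≤ (1 - 1 / √c) / 4 / √c := by gcongr ?_ / _ / _; linarith
    _ = _ := by field_simp; norm_num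

lemma exists_pos_le_minimaxRisk {C : ℝ} (hC : 0 < C) :
    ∃ ε : ℝ, 0 < ε ∧
      ∀ S n : ℕ, 2 ≤ S → (n : ℝ) ≤ C * S → ENNReal.ofReal ε ≤ minimaxRisk S n := by
  obtain ⟨δ, h0, h1, h2⟩ : ∃ δ : ℝ, 0 < δ ∧ δ ≤ 1 / 4 ∧ 16 * C * δ ≤ 1 := by
    refine ⟨min (1 / 4) (1 / (16 * C)), by positivity, min_le_left _ _, ?_⟩
    rw [mul_comm, ← le_div_iff₀ (by positivity)]
    exact min_le_right _ _
  refine ⟨δ * (1 - 2 * δ) * (1 - 1 / 2), by have : 0 < 1 - 2 * δ := by linarith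
                                            positivity, fun S n hS hn => ?_⟩
  obtain ⟨m, rfl⟩ : ∃ m, S = m + 1 := ⟨S - 1, by omega⟩
  have hm : (1 : ℝ) ≤ m := by exact_mod_cast (by omega : 1 ≤ m)
  refine le_trans (ENNReal.ofReal_le_ofReal ?_)
    (le_minimaxRisk_succ n (by omega) h0 (by linarith : δ < 1 / 2))
  refine mul_le_mul_of_nonneg_left (sub_le_sub_left ?_ 1) (mul_nonneg h0.le (by linarith))
  rw [Real.sqrt_le_left (by norm_num)]
  have hn2 : (n : ℝ) / m ≤ 2 * C := by
    rw [div_le_iff₀ (by linarith)]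
    push_cast at hn
    nlinarith
  calc (n : ℝ) * (δ ^ 2 / m + δ / (m : ℝ) ^ 2) = n / m * (δ ^ 2 + δ * (1 / m)) := by
        field_simp
    _ ≤ 2 * C * (δ * 1 + δ * 1) := by
        rw [sq]
        gcongr
        · linarith
        · rw [div_le_one (by linarith)]; exact hm
    _ ≤ (1 / 2) ^ 2 := by linarith

theorem corollary4 :
    -- the lower bound in the regime `S = n / c`, for every integer rounding of `n / c`
    (∀ S : ℝ → ℕ → ℕ,
      (∀ c : ℝ, 0 < c → Tendsto (fun n : ℕ => (S c n : ℝ) / n) atTop (𝓝 (1 / c))) →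
      ENNReal.ofReal (Real.sqrt (Real.exp 1) / 8) ≤
        liminf (fun c : ℝ => ENNReal.ofReal (Real.sqrt c) *
          liminf (fun n : ℕ => minimaxRisk (S c n) n) atTop) atTop) ∧
    0 < Real.sqrt (Real.exp 1) / 8 ∧
    -- a number of samples of the order of `S` is necessary
    (∀ C : ℝ, 0 < C → ∃ ε : ℝ, 0 < ε ∧
      ∀ S n : ℕ, 2 ≤ S → (n : ℝ) ≤ C * S → ENNReal.ofReal ε ≤ minimaxRisk S n) ∧
    -- the empirical distribution attains the optimal rate `Θ(c ^ (-1/2))`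
    (∃ a A c₀ : ℝ, 0 < a ∧ 0 < A ∧ 0 < c₀ ∧
      ∀ c : ℝ, c₀ ≤ c → ∀ S : ℕ → ℕ,
        Tendsto (fun n : ℕ => (S n : ℝ) / n) atTop (𝓝 (1 / c)) →
        ENNReal.ofReal (a / Real.sqrt c) ≤ liminf (fun n : ℕ => minimaxRisk (S n) n) atTop ∧
        limsup (fun n : ℕ => maxRisk (empirical (S n) n)) atTop ≤
          ENNReal.ofReal (A / Real.sqrt c)) := by
  have he : 0 < √(Real.exp 1) / 8 := by positivity
  refine ⟨fun S hS => ?_, he, fun C hC => exists_pos_le_minimaxRisk hC,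
    √(Real.exp 1) / 8, 1, 100, he, one_pos, by norm_num, fun c hc S hS =>
      ⟨sqrt_exp_one_div_le_liminf_minimaxRisk hc hS, ?_⟩⟩
  · refine le_liminf_of_le (by isBoundedDefault) ?_
    filter_upwards [eventually_ge_atTop 100] with c hc
    have hc0 : 0 < c := by linarith
    have hs0 : 0 < √c := Real.sqrt_pos.2 hc0
    calc ENNReal.ofReal (√(Real.exp 1) / 8)
        = ENNReal.ofReal √c * ENNReal.ofReal (√(Real.exp 1) / 8 / √c) := by
          rw [← ENNReal.ofReal_mul hs0.le, mul_div_cancel₀ _ hs0.ne']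
      _ ≤ _ := by
          gcongr
          exact sqrt_exp_one_div_le_liminf_minimaxRisk hc (hS c hc0)
  · have hlim : Tendsto (fun n : ℕ => ENNReal.ofReal √((S n : ℝ) / n)) atTop
        (𝓝 (ENNReal.ofReal (1 / √c))) := by
      have := ENNReal.tendsto_ofReal ((Real.continuous_sqrt.tendsto _).comp hS)
      rwa [Real.sqrt_div zero_le_one, Real.sqrt_one] at this
    rw [← hlim.limsup_eq]
    refine limsup_le_limsup ?_
    filter_upwards [eventually_gt_atTop 0] with n hn using maxRisk_empirical_le hn
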